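/- Let $\mathcal M=(S,\mathit{Act},P,s_{\mathrm{init}})$ be a Markov decision process: $S$ and $\mathit{Act}$ are finite, $P:S\times\mathit{Act}\times S\to[0,1]\cap\mathbb Q$, $\sum_t P(s,\alpha,t)\in\{0,1\}$ for all $s,\alpha$ (the action $\alpha$ is enabled in $s$ if the sum is $1$), every state has an enabled action, and $s_{\mathrm{init}}\in S$. Paths are finite or infinite sequences $s_0\alpha_0s_1\alpha_1\dots$ with $P(s_i,\alpha_i,s_{i+1})>0$ for all $i$. A scheduler $\mathfrak S$ assigns to every finite path $\pi$ a probability distribution $\mathfrak S(\pi)$ over the actions enabled in the last state of $\pi$. The infinite paths carry the topology and the $\sigma$-algebra generated by the cylinder sets $\mathrm{Cyl}(\pi)$ (all infinite extensions of a finite path $\pi$), and $\Pr^{\mathfrak S}_{\mathcal M}$ is the unique probability measure with $\Pr^{\mathfrak S}_{\mathcal M}(\mathrm{Cyl}(\pi))=\prod_{i<k}\mathfrak S(s_0\alpha_0\dots s_i)(\alpha_i)\,P(s_i,\alpha_i,s_{i+1})$ for every finite path $\pi=s_0\alpha_0\dots s_k$ with $s_0=s_{\mathrm{init}}$. Let $X$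 be a real-valued measurable function on the infinite paths. Write $\mathbb E^{\mathfrak S}(X)$ and $\mathbb V^{\mathfrak S}(X)$ for its expectation and variance under $\Pr^{\mathfrak S}_{\mathcal M}$, and let $\mathbb E^{\min}(X)=\inf_{\mathfrak S}\mathbb E^{\mathfrak S}(X)$, $\mathbb E^{\max}(X)=\sup_{\mathfrak S}\mathbb E^{\mathfrak S}(X)$ and $\mathbb V^{\max}(X)=\sup_{\mathfrak S}\mathbb V^{\mathfrak S}(X)$. For schedulers $\mathfrak S,\mathfrak T$ let $$\mathbb V^{\mathfrak S,\mathfrak T}(X)=\tfrac12\,\mathbb E^{\mathfrak S\otimes\mathfrak T}_{\mathcal M\otimes\mathcal M}\big((X_1-X_2)^2\big),$$ where $\mathcal M\otimes\mathcal M$ is the synchronous product (states $S\times S$, actions $\mathit{Act}\times\mathit{Act}$, transition probabilities $P(s,\alpha,t)P(s',\beta,t')$, initial state $(s_{\mathrm{init}},s_{\mathrm{init}})$), $(\mathfrak S\otimes\mathfrak T)(\pi)(\alpha,\beta)=\mathfrak S(\pi_1)(\alpha)\,\mathfrak T(\pi_2)(\beta)$ with $\pi_1,\pi_2$ the projections of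 $\pi$ to the two components, and $X_1,X_2$ are $X$ applied to the first and second projection of an infinite path. Let $\mathbb V^{\mathrm{dem}}(X)=\sup_{\mathfrak S,\mathfrak T}\mathbb V^{\mathfrak S,\mathfrak T}(X)$ and $$\mathrm{NDS}(\mathcal M,X)=\frac{\mathbb V^{\mathrm{dem}}(X)-\mathbb V^{\max}(X)}{\mathbb V^{\max}(X)}.$$ Assume that $0<\mathbb V^{\max}(X)<\infty$ and $\sup_{\mathfrak S}|\mathbb E^{\mathfrak S}(X)|<\infty$. If $\mathrm{NDS}(\mathcal M,X)=1$, then the following hold. 1. For every $\varepsilon>0$ there are schedulers $\mathfrak{Min}_\varepsilon$ and $\mathfrak{Max}_\varepsilon$ with $\mathbb E^{\mathfrak{Min}_\varepsilon}(X)\le\mathbb E^{\min}(X)+\varepsilon$ and $\mathbb V^{\mathfrak{Min}_\varepsilon}(X)\le\varepsilon$, and $\mathbb E^{\mathfrak{Max}_\varepsilon}(X)\ge\mathbb E^{\max}(X)-\varepsilon$ and $\mathbb V^{\mathfrak{Max}_\varepsilon}(X)\le\varepsilon$. 2. If $\mathfrak S_0,\mathfrak S_1$ are schedulers with $\mathbb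 V^{\mathrm{dem}}(X)=\mathbb V^{\mathfrak S_0,\mathfrak S_1}(X)$, then for $i=0$ or $i=1$ we have $\Pr^{\mathfrak S_i}_{\mathcal M}(X=\mathbb E^{\min}(X))=1$ and $\Pr^{\mathfrak S_{1-i}}_{\mathcal M}(X=\mathbb E^{\max}(X))=1$. 3. If $X$ is bounded and continuous with respect to the topology generated by the cylinder sets, then there are schedulers $\mathfrak{Min}$ and $\mathfrak{Max}$ with $\Pr^{\mathfrak{Min}}_{\mathcal M}(X=\mathbb E^{\min}(X))=1$ and $\Pr^{\mathfrak{Max}}_{\mathcal M}(X=\mathbb E^{\max}(X))=1$. -/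

import Mathlib

open MeasureTheory ProbabilityTheory
open scoped ENNReal

/-- A (finite) Markov decision process with state set `S` and action set `Act`. -/
structure MDP (S Act : Type*) [Fintype S] where
  P : S → Act → S → ℚ
  init : S
  P_mem : ∀ s α t, P s α t ∈ Set.Icc (0 : ℚ) 1
  P_sum : ∀ s α, ∑ t, P s α t = 0 ∨ ∑ t, P s α t = 1
  exists_enabled : ∀ s, ∃ α, ∑ t, P s α t = 1

namespace MDP

section Basic

variable {S Act : Type*} [Fintype S]

/-- Action `α` is enabled in state `s`. -/
def Enabled (M : MDP S Act) (s : S) (α : Act) : Prop := ∑ t, M.P s α t = 1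

/-- Finite paths `s₀ α₀ s₁ … αₙ₋₁ sₙ` with `n` transitions. -/
@[ext]
structure FinPath (M : MDP S Act) (n : ℕ) where
  state : Fin (n + 1) → S
  act : Fin n → Act
  valid : ∀ i : Fin n, 0 < M.P (state i.castSucc) (act i) (state i.succ)

/-- Infinite paths `s₀ α₀ s₁ α₁ …`. -/
@[ext]
structure Path (M : MDP S Act) where
  state : ℕ → S
  act : ℕ → Act
  valid : ∀ i, 0 < M.P (state i) (act i) (state (i + 1))

variable {M : MDP S Act}

/-- The last state of a finite path. -/
def FinPath.last {n : ℕ} (π : M.FinPath n) : S := π.state (Fin.last n)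

/-- The prefix with `k` transitions of a finite path. -/
def FinPath.take {n : ℕ} (π : M.FinPath n) {k : ℕ} (h : k ≤ n) : M.FinPath k where
  state i := π.state ⟨i, by omega⟩
  act i := π.act ⟨i, by omega⟩
  valid i := π.valid ⟨i, by omega⟩

/-- The prefix with `n` transitions of an infinite path. -/
def Path.take (ρ : M.Path) (n : ℕ) : M.FinPath n where
  state i := ρ.state i
  act i := ρ.act i
  valid i := ρ.valid i

/-- The cylinder set of all infinite extensions of a finite path. -/
def FinPath.cyl {n : ℕ} (π : M.FinPath n) : Set M.Path := {ρ | ρ.take n = π}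

/-- The set of all cylinder sets. -/
def cylinders (M : MDP S Act) : Set (Set M.Path) :=
  {C | ∃ (n : ℕ) (π : M.FinPath n), C = π.cyl}

/-- The topology on infinite paths generated by the cylinder sets. -/
instance (M : MDP S Act) : TopologicalSpace M.Path := .generateFrom M.cylinders

/-- The σ-algebra on infinite paths generated by the cylinder sets. -/
instance (M : MDP S Act) : MeasurableSpace M.Path := .generateFrom M.cylinders

variable [Fintype Act]

/-- A (history-dependent, randomized) scheduler: it maps every finite path to a probability
distribution over the actions enabled in the last state of the path. -/
@[ext]
structure Scheduler (M : MDP S Act) where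
  prob : ∀ {n : ℕ}, M.FinPath n → Act → ℝ
  nonneg : ∀ {n : ℕ} (π : M.FinPath n) (α : Act), 0 ≤ prob π α
  sum_one : ∀ {n : ℕ} (π : M.FinPath n), ∑ α, prob π α = 1
  enabled : ∀ {n : ℕ} (π : M.FinPath n) (α : Act), ¬ M.Enabled π.last α → prob π α = 0

/-- The probability `P^σ(π)` that a finite path `π` is realized under the scheduler `σ`. -/
noncomputable def Scheduler.pathProb (σ : M.Scheduler) {n : ℕ} (π : M.FinPath n) : ℝ :=
  ∏ i : Fin n, σ.prob (π.take i.isLt.le) (π.act i) *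
    (M.P (π.state i.castSucc) (π.act i) (π.state i.succ) : ℝ)

end Basic

section Existence

variable {S Act : Type*} [Fintype S] {M : MDP S Act}

/-- Extension of a finite path by one transition. -/
def FinPath.snoc {n : ℕ} (π : M.FinPath n) (α : Act) (t : S) (h : 0 < M.P π.last α t) :
    M.FinPath (n + 1) where
  state := Fin.snoc (α := fun _ => S) π.state t
  act := Fin.snoc (α := fun _ => Act) π.act α
  valid i := by
    induction i using Fin.lastCases with
    | last =>
      rw [Fin.succ_last, Fin.snoc_last, Fin.snoc_last, Fin.snoc_castSucc]
      exact h
    | cast i =>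
      rw [Fin.succ_castSucc, Fin.snoc_castSucc, Fin.snoc_castSucc, Fin.snoc_castSucc]
      exact π.valid i

theorem FinPath.take_snoc {n : ℕ} (π : M.FinPath n) (α : Act) (t : S)
    (h : 0 < M.P π.last α t) : (π.snoc α t h).take n.le_succ = π := by
  ext i
  · exact Fin.snoc_castSucc (α := fun _ => S) t π.state i
  · exact Fin.snoc_castSucc (α := fun _ => Act) α π.act i

theorem FinPath.act_snoc {n : ℕ} (π : M.FinPath n) (α : Act) (t : S)
    (h : 0 < M.P π.last α t) : (π.snoc α t h).act (Fin.last n) = α :=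
  Fin.snoc_last (α := fun _ => Act) α π.act

theorem FinPath.last_snoc {n : ℕ} (π : M.FinPath n) (α : Act) (t : S)
    (h : 0 < M.P π.last α t) : (π.snoc α t h).last = t :=
  Fin.snoc_last (α := fun _ => S) t π.state

theorem FinPath.eq_of_take {n : ℕ} {π ρ : M.FinPath (n + 1)}
    (h : π.take n.le_succ = ρ.take n.le_succ) (ha : π.act (Fin.last n) = ρ.act (Fin.last n))
    (hs : π.last = ρ.last) : π = ρ := by
  ext i
  · induction i using Fin.lastCases with
    | last => exact hs
    | cast i => exact congrFun (congrArg FinPath.state h) i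
  · induction i using Fin.lastCases with
    | last => exact ha
    | cast i => exact congrFun (congrArg FinPath.act h) i

theorem exists_path (M : MDP S Act) : ∃ ρ : M.Path, ρ.state 0 = M.init := by
  have key : ∀ s, ∃ p : Act × S, 0 < M.P s p.1 p.2 := by
    intro s
    obtain ⟨α, hα⟩ := M.exists_enabled s
    obtain ⟨t, -, ht⟩ := Finset.exists_ne_zero_of_sum_ne_zero (hα.trans_ne one_ne_zero)
    exact ⟨(α, t), lt_of_le_of_ne (M.P_mem s α t).1 ht.symm⟩
  choose f hf using key
  refine ⟨⟨fun n => (fun s => (f s).2)^[n] M.init,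
    fun n => (f ((fun s => (f s).2)^[n] M.init)).1, fun i => ?_⟩, rfl⟩
  rw [Function.iterate_succ_apply']
  exact hf _

variable [Fintype Act]

instance (n : ℕ) : Finite (M.FinPath n) :=
  Finite.of_injective (fun π : M.FinPath n => (π.state, π.act)) fun π ρ h => by
    simp only [Prod.mk.injEq] at h
    exact FinPath.ext h.1 h.2

instance (n : ℕ) : MeasurableSpace (M.FinPath n) := ⊤

instance (n : ℕ) : DiscreteMeasurableSpace (M.FinPath n) := ⟨fun _ => trivial⟩

/-- The law of the extension of a finite path by one step under `σ`. -/
noncomputable def Scheduler.step (σ : M.Scheduler) {n : ℕ} (π : M.FinPath n) :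
    Measure (M.FinPath (n + 1)) :=
  open Classical in
  ∑ α, ∑ t, if h : 0 < M.P π.last α t then
    ENNReal.ofReal (σ.prob π α * (M.P π.last α t : ℝ)) • Measure.dirac (π.snoc α t h) else 0

instance (σ : M.Scheduler) {n : ℕ} (π : M.FinPath n) : IsProbabilityMeasure (σ.step π) := by
  constructor
  have h1 : σ.step π Set.univ = ∑ α, ∑ t, ENNReal.ofReal (σ.prob π α * (M.P π.last α t : ℝ)) := by
    simp only [Scheduler.step, Measure.finsetSum_apply]
    refine Finset.sum_congr rfl fun α _ => Finset.sum_congr rfl fun t _ => ?_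
    split_ifs with h
    · simp
    · have h0 : M.P π.last α t = 0 := le_antisymm (not_lt.1 h) (M.P_mem _ _ _).1
      simp [h0]
  have h2 : ∀ α t, 0 ≤ σ.prob π α * (M.P π.last α t : ℝ) := fun α t =>
    mul_nonneg (σ.nonneg _ _) (by exact_mod_cast (M.P_mem _ _ _).1)
  rw [h1]
  simp_rw [← ENNReal.ofReal_sum_of_nonneg fun t _ => h2 _ t]
  rw [← ENNReal.ofReal_sum_of_nonneg fun α _ => Finset.sum_nonneg fun t _ => h2 α t,
    ← ENNReal.ofReal_one, ← σ.sum_one π]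
  congr 1
  refine Finset.sum_congr rfl fun α _ => ?_
  rw [← Finset.mul_sum]
  by_cases hα : M.Enabled π.last α
  · have : ∑ t, (M.P π.last α t : ℝ) = 1 := by exact_mod_cast hα
    rw [this, mul_one]
  · rw [σ.enabled π α hα, zero_mul]

theorem Scheduler.step_singleton (σ : M.Scheduler) {n : ℕ} (ρ : M.FinPath (n + 1)) :
    σ.step (ρ.take n.le_succ) {ρ} =
      ENNReal.ofReal (σ.prob (ρ.take n.le_succ) (ρ.act (Fin.last n)) *
        (M.P (ρ.take n.le_succ).last (ρ.act (Fin.last n)) ρ.last : ℝ)) := by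
  classical
  simp only [Scheduler.step, Measure.finsetSum_apply]
  rw [Finset.sum_eq_single (ρ.act (Fin.last n)), Finset.sum_eq_single ρ.last]
  · have h : 0 < M.P (ρ.take n.le_succ).last (ρ.act (Fin.last n)) ρ.last := ρ.valid (Fin.last n)
    rw [dif_pos h]
    have : (ρ.take n.le_succ).snoc (ρ.act (Fin.last n)) ρ.last h = ρ :=
      FinPath.eq_of_take (FinPath.take_snoc _ _ _ _) (FinPath.act_snoc _ _ _ _)
        (FinPath.last_snoc _ _ _ _)
    simp [this]
  · intro t _ ht
    split_ifs with h
    · have : (ρ.take n.le_succ).snoc (ρ.act (Fin.last n)) t h ≠ ρ := fun e =>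
        ht (by rw [← FinPath.last_snoc _ _ _ h, e])
      simp [this]
    · simp
  · simp
  · intro α _ hα
    refine Finset.sum_eq_zero fun t _ => ?_
    split_ifs with h
    · have : (ρ.take n.le_succ).snoc α t h ≠ ρ := fun e =>
        hα (by rw [← FinPath.act_snoc _ _ _ h, e])
      simp [this]
    · simp
  · simp

theorem Scheduler.step_take (σ : M.Scheduler) {n : ℕ} (π : M.FinPath n) :
    σ.step π {ρ | ρ.take n.le_succ ≠ π} = 0 := by
  classical
  simp only [Scheduler.step, Measure.finsetSum_apply]
  refine Finset.sum_eq_zero fun α _ => Finset.sum_eq_zero fun t _ => ?_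
  split_ifs with h
  · simp [FinPath.take_snoc]
  · simp

theorem Scheduler.pathProb_succ (σ : M.Scheduler) {n : ℕ} (ρ : M.FinPath (n + 1)) :
    σ.pathProb ρ = σ.pathProb (ρ.take n.le_succ) *
      (σ.prob (ρ.take n.le_succ) (ρ.act (Fin.last n)) *
        (M.P (ρ.take n.le_succ).last (ρ.act (Fin.last n)) ρ.last : ℝ)) := by
  rw [Scheduler.pathProb, Fin.prod_univ_castSucc]
  rfl

theorem Scheduler.pathProb_nonneg (σ : M.Scheduler) {n : ℕ} (π : M.FinPath n) :
    0 ≤ σ.pathProb π :=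
  Finset.prod_nonneg fun _ _ =>
    mul_nonneg (σ.nonneg _ _) (by exact_mod_cast (M.P_mem _ _ _).1)

/-- The one-step kernels of the process of growing finite paths. -/
noncomputable def Scheduler.kernel (σ : M.Scheduler) (n : ℕ) :
    Kernel (Π i : Finset.Iic n, M.FinPath i) (M.FinPath (n + 1)) where
  toFun x := σ.step (x ⟨n, Finset.mem_Iic.2 le_rfl⟩)
  measurable' :=
    (Measurable.of_discrete (f := fun π : M.FinPath n => σ.step π)).comp (measurable_pi_apply _)

instance (σ : M.Scheduler) (n : ℕ) : IsMarkovKernel (σ.kernel n) :=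
  ⟨fun x => inferInstanceAs (IsProbabilityMeasure (σ.step (x ⟨n, Finset.mem_Iic.2 le_rfl⟩)))⟩

/-- The law of the sequence of growing finite paths. -/
theorem Scheduler.exists_law (σ : M.Scheduler) : ∃ μ : Measure (Π n, M.FinPath n),
    IsProbabilityMeasure μ ∧ (∀ᵐ x ∂μ, ∀ n, (x (n + 1)).take n.le_succ = x n) ∧
    ∀ (n : ℕ) (π : M.FinPath n), π.state 0 = M.init →
      μ {x | x n = π} = ENNReal.ofReal (σ.pathProb π) := by
  obtain ⟨ρ₀, hρ₀⟩ := M.exists_path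
  let x₀ : Π i : Finset.Iic 0, M.FinPath i := fun i => ρ₀.take i
  let μ := Kernel.traj σ.kernel 0 x₀
  have hμ : ∀ (n : ℕ) (A : Set (Π n, M.FinPath n)), MeasurableSet A →
      μ A = ∫⁻ x, Kernel.traj σ.kernel n (Preorder.frestrictLe n x) A ∂μ := by
    intro n A hA
    change Kernel.traj σ.kernel 0 x₀ A = _
    rw [← Kernel.traj_comp_partialTraj (κ := σ.kernel) (Nat.zero_le n),
      Kernel.comp_apply' _ _ _ hA, ← Kernel.traj_map_frestrictLe_apply,
      lintegral_map (Kernel.measurable_coe _ hA) (by fun_prop)]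
  have hnext : ∀ (n : ℕ) (y : Π i : Finset.Iic n, M.FinPath i) (B : Set (M.FinPath (n + 1))),
      Kernel.traj σ.kernel n y {x | x (n + 1) ∈ B} =
        σ.step (y ⟨n, Finset.mem_Iic.2 le_rfl⟩) B := by
    intro n y B
    have h := congrArg (fun κ => κ y B) (Kernel.map_traj_succ_self (κ := σ.kernel) (a := n))
    rw [Kernel.map_apply' _ (by fun_prop) _ (MeasurableSet.of_discrete)] at h
    exact h
  have hcur : ∀ (n : ℕ) (y : Π i : Finset.Iic n, M.FinPath i),
      Kernel.traj σ.kernel n y {x | x n ≠ y ⟨n, Finset.mem_Iic.2 le_rfl⟩} = 0 := by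
    intro n y
    have h := congrArg (fun κ => κ y {z | z ⟨n, Finset.mem_Iic.2 le_rfl⟩ ≠
      y ⟨n, Finset.mem_Iic.2 le_rfl⟩})
      (Kernel.traj_map_frestrictLe_of_le (κ := σ.kernel) (le_refl n))
    have hm : MeasurableSet {z : Π i : Finset.Iic n, M.FinPath i |
        z ⟨n, Finset.mem_Iic.2 le_rfl⟩ ≠ y ⟨n, Finset.mem_Iic.2 le_rfl⟩} :=
      (measurable_pi_apply (X := fun i : Finset.Iic n => M.FinPath i)
        ⟨n, Finset.mem_Iic.2 le_rfl⟩)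
        (MeasurableSet.of_discrete (s := {π | π ≠ y ⟨n, Finset.mem_Iic.2 le_rfl⟩}))
    rw [Kernel.map_apply' _ (by fun_prop) _ hm, Kernel.deterministic_apply' _ _ hm] at h
    refine Eq.trans h ?_
    simp [Preorder.frestrictLe₂]
  refine ⟨μ, inferInstance, ?_, ?_⟩
  · rw [ae_all_iff]
    intro n
    rw [ae_iff, hμ n]
    · refine (lintegral_eq_zero_iff' ?_).2 (Filter.Eventually.of_forall fun x => ?_)
      · refine Measurable.aemeasurable ?_
        refine (Kernel.measurable_coe _ ?_).comp (Preorder.measurable_frestrictLe n)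
        exact (Measurable.of_discrete (f := fun p : M.FinPath (n + 1) × M.FinPath n =>
          ¬ p.1.take n.le_succ = p.2)).comp (f := fun x : Π n, M.FinPath n => (x (n + 1), x n))
          (by fun_prop) |>.setOf
      · refine measure_mono_null (t := {z | z n ≠ x n} ∪
          {z | z (n + 1) ∈ {ρ | ρ.take n.le_succ ≠ x n}}) ?_ ?_
        · intro z hz
          by_cases h : z n = x n
          · right
            simpa [h] using hz
          · left
            exact h
        · rw [measure_union_null_iff]
          refine ⟨hcur n (Preorder.frestrictLe n x), ?_⟩
          rw [hnext]
          exact σ.step_take _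
    · exact (Measurable.of_discrete (f := fun p : M.FinPath (n + 1) × M.FinPath n =>
          ¬ p.1.take n.le_succ = p.2)).comp (f := fun x : Π n, M.FinPath n => (x (n + 1), x n))
          (by fun_prop) |>.setOf
  · intro n
    induction n with
    | zero =>
      intro π hπ
      have h1 : π = ρ₀.take 0 := by
        ext i
        · rw [show i = 0 from Fin.ext (by omega), hπ]
          exact hρ₀.symm
        · exact i.elim0
      have h2 : μ {x | x 0 = π}ᶜ = 0 := by
        rw [h1]
        exact hcur 0 x₀
      have h3 : μ {x | x 0 = π} = 1 := by
        rwa [prob_compl_eq_zero_iff] at h2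
        exact (Measurable.of_discrete (f := fun p : M.FinPath 0 =>
          p = π)).comp (f := fun x : Π n, M.FinPath n => x 0) (by fun_prop) |>.setOf
      rw [h3]
      simp [Scheduler.pathProb]
    | succ n ih =>
      intro π hπ
      rw [hμ n]
      · have h1 : ∀ x : Π n, M.FinPath n,
            Kernel.traj σ.kernel n (Preorder.frestrictLe n x) {z | z (n + 1) = π} =
            Set.indicator {x : Π n, M.FinPath n | x n = π.take n.le_succ}
              (fun _ => σ.step (π.take n.le_succ) {π}) x := by
          intro x
          rw [show {z : Π n, M.FinPath n | z (n + 1) = π} = {z | z (n + 1) ∈ ({π} : Set _)}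
            from rfl, hnext]
          by_cases hx : x n = π.take n.le_succ
          · rw [Set.indicator_of_mem (by exact hx), ← hx]
            rfl
          · rw [Set.indicator_of_notMem (by exact hx)]
            refine measure_mono_null ?_ (σ.step_take (x n))
            rintro _ rfl
            exact fun h => hx h.symm
        simp_rw [h1]
        rw [lintegral_indicator_const, ih _ (by exact hπ), σ.step_singleton, mul_comm,
          ← ENNReal.ofReal_mul (σ.pathProb_nonneg _), ← σ.pathProb_succ]
        exact (Measurable.of_discrete (f := fun p : M.FinPath n =>
          p = π.take n.le_succ)).comp (f := fun x : Π n, M.FinPath n => x n)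
          (by fun_prop) |>.setOf
      · exact (Measurable.of_discrete (f := fun p : M.FinPath (n + 1) =>
          p = π)).comp (f := fun x : Π n, M.FinPath n => x (n + 1)) (by fun_prop) |>.setOf

/-- Existence of the path measure: a probability measure on the cylinder σ-algebra that gives
every cylinder `Cyl(π)` of a finite path `π` starting in `s_init` the probability `P^σ(π)`. -/
theorem Scheduler.exists_measure (σ : M.Scheduler) : ∃ μ : Measure M.Path,
    IsProbabilityMeasure μ ∧ ∀ (n : ℕ) (π : M.FinPath n), π.state 0 = M.init →
      μ π.cyl = ENNReal.ofReal (σ.pathProb π) := by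
  classical
  obtain ⟨μ, hμ, hc, hμπ⟩ := σ.exists_law
  obtain ⟨ρ₀, -⟩ := M.exists_path
  let F : (Π n, M.FinPath n) → M.Path := fun x =>
    if h : ∀ n, (x (n + 1)).take n.le_succ = x n then
      { state := fun n => (x n).last
        act := fun n => (x (n + 1)).act (Fin.last n)
        valid := fun n => by
          have h1 := (x (n + 1)).valid (Fin.last n)
          have h2 : (x (n + 1)).state (Fin.last n).castSucc = (x n).last := by
            rw [← h n]
            rfl
          rw [h2] at h1
          exact h1 }
    else ρ₀
  have hF : ∀ x : Π n, M.FinPath n, (∀ n, (x (n + 1)).take n.le_succ = x n) →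
      ∀ n, (F x).take n = x n := by
    intro x hx n
    have e : F x = _ := dif_pos hx
    induction n with
    | zero =>
      ext i
      · rw [show i = 0 from Fin.ext (by omega), e]
        rfl
      · exact i.elim0
    | succ n ih =>
      refine FinPath.eq_of_take ?_ ?_ ?_
      · rw [hx n]
        exact ih
      · rw [e]
        rfl
      · rw [e]
        rfl
  have hG : MeasurableSet {x : Π n, M.FinPath n | ∀ n, (x (n + 1)).take n.le_succ = x n} := by
    refine MeasurableSet.congr (MeasurableSet.iInter (f := fun n (x : Π n, M.FinPath n) =>
      (x (n + 1)).take n.le_succ = x n) fun n => ?_) ?_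
    · exact (Measurable.of_discrete (f := fun p : M.FinPath (n + 1) × M.FinPath n =>
        p.1.take n.le_succ = p.2)).comp (f := fun x : Π n, M.FinPath n => (x (n + 1), x n))
        (by fun_prop) |>.setOf
    · ext x
      exact Set.mem_iInter
  have hP : ∀ (n : ℕ) (π : M.FinPath n), MeasurableSet {x : Π n, M.FinPath n | x n = π} :=
    fun n π => (Measurable.of_discrete (f := fun p : M.FinPath n =>
      p = π)).comp (f := fun x : Π n, M.FinPath n => x n) (by fun_prop) |>.setOf
  have hFm : Measurable F := by
    refine measurable_generateFrom ?_
    rintro _ ⟨n, π, rfl⟩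
    have : F ⁻¹' π.cyl = ({x | ∀ n, (x (n + 1)).take n.le_succ = x n} ∩ {x | x n = π}) ∪
        ({x | ∀ n, (x (n + 1)).take n.le_succ = x n}ᶜ ∩ {_x | ρ₀ ∈ π.cyl}) := by
      ext x
      by_cases hx : ∀ n, (x (n + 1)).take n.le_succ = x n
      · have h1 := hF x hx n
        simp [FinPath.cyl, hx, h1]
      · have h1 : F x = ρ₀ := dif_neg hx
        have h2 : x ∉ {x : Π n, M.FinPath n | ∀ n, (x (n + 1)).take n.le_succ = x n} := hx
        simp only [Set.mem_preimage, h1, Set.mem_union, Set.mem_inter_iff, h2, false_and,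
          false_or, Set.mem_compl_iff, not_false_eq_true, true_and]
        rfl
    rw [this]
    exact (hG.inter (hP n π)).union (hG.compl.inter (MeasurableSet.const _))
  refine ⟨μ.map F, Measure.isProbabilityMeasure_map hFm.aemeasurable, fun n π hπ => ?_⟩
  rw [Measure.map_apply hFm (MeasurableSpace.measurableSet_generateFrom ⟨n, π, rfl⟩),
    ← hμπ n π hπ]
  refine measure_congr ?_
  filter_upwards [hc] with x hx
  have h1 := hF x hx n
  exact propext (show (F x).take n = π ↔ x n = π by rw [h1])

/-- Uniqueness of the path measure. -/
theorem Scheduler.measure_unique (σ : M.Scheduler) (μ ν : Measure M.Path)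
    [IsProbabilityMeasure μ] [IsProbabilityMeasure ν]
    (hμ : ∀ (n : ℕ) (π : M.FinPath n), π.state 0 = M.init →
      μ π.cyl = ENNReal.ofReal (σ.pathProb π))
    (hν : ∀ (n : ℕ) (π : M.FinPath n), π.state 0 = M.init →
      ν π.cyl = ENNReal.ofReal (σ.pathProb π)) : μ = ν := by
  have hm : ∀ (n : ℕ) (π : M.FinPath n), MeasurableSet π.cyl :=
    fun n π => MeasurableSpace.measurableSet_generateFrom ⟨n, π, rfl⟩
  have h0 : ∀ (μ : Measure M.Path) [IsProbabilityMeasure μ],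
      (∀ (n : ℕ) (π : M.FinPath n), π.state 0 = M.init →
        μ π.cyl = ENNReal.ofReal (σ.pathProb π)) →
      ∀ (n : ℕ) (π : M.FinPath n), π.state 0 ≠ M.init → μ π.cyl = 0 := by
    intro μ _ h n π hπ
    let e : M.FinPath 0 := ⟨fun _ => M.init, fun i => i.elim0, fun i => i.elim0⟩
    have h1 : μ e.cyl = 1 := by
      rw [h 0 e rfl]
      simp [Scheduler.pathProb]
    refine measure_mono_null ?_ ((prob_compl_eq_zero_iff (hm 0 e)).2 h1)
    intro ρ hρ he
    refine hπ ?_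
    have h2 : ρ.take n = π := hρ
    have h3 : ρ.take 0 = e := he
    rw [← h2]
    exact congrFun (congrArg FinPath.state h3) 0
  refine ext_of_generate_finite M.cylinders rfl ?_ ?_ (by simp)
  · have key : ∀ (m n : ℕ) (_ : m ≤ n) (π : M.FinPath m) (π₂ : M.FinPath n),
        (π.cyl ∩ π₂.cyl).Nonempty → π.cyl ∩ π₂.cyl = π₂.cyl := by
      rintro m n hmn π π₂ ⟨ρ, h1, h2⟩
      refine Set.inter_eq_right.2 fun ρ₂ h3 => ?_
      have h4 : (ρ.take n).take hmn = (ρ₂.take n).take hmn := by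
        rw [show ρ.take n = π₂ from h2, show ρ₂.take n = π₂ from h3]
      exact Eq.trans (Eq.symm h4) h1
    rintro _ ⟨m, π, rfl⟩ _ ⟨n, π₂, rfl⟩ h
    rcases le_total m n with hmn | hmn
    · rw [key m n hmn π π₂ h]
      exact ⟨n, π₂, rfl⟩
    · rw [Set.inter_comm] at h ⊢
      rw [key n m hmn π₂ π h]
      exact ⟨m, π, rfl⟩
  · rintro _ ⟨n, π, rfl⟩
    by_cases hπ : π.state 0 = M.init
    · rw [hμ n π hπ, hν n π hπ]
    · rw [h0 μ hμ n π hπ, h0 ν hν n π hπ]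

end Existence

section Quantities

variable {S Act : Type*} [Fintype S] [Fintype Act] {M : MDP S Act}

/-- The probability measure `Pr^σ_M` on infinite paths induced by the scheduler `σ` and the
initial state: it is the (unique) probability measure whose value on `Cyl(π)` is `P^σ(π)`, for
every finite path `π` starting in the initial state. -/
noncomputable def Scheduler.Pr (σ : M.Scheduler) : Measure M.Path := σ.exists_measure.choose

instance (σ : M.Scheduler) : IsProbabilityMeasure σ.Pr := σ.exists_measure.choose_spec.1

theorem Scheduler.Pr_cyl (σ : M.Scheduler) {n : ℕ} (π : M.FinPath n)
    (h : π.state 0 = M.init) : σ.Pr π.cyl = ENNReal.ofReal (σ.pathProb π) :=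
  σ.exists_measure.choose_spec.2 n π h

/-- The expected value of `X` under the scheduler `σ`. -/
noncomputable def Scheduler.expect (σ : M.Scheduler) (X : M.Path → ℝ) : ℝ := ∫ ρ, X ρ ∂σ.Pr

/-- The variance of `X` under the scheduler `σ`, as a value in `[0, ∞]`.
It is infinite if the measurable function `X` is not square-integrable. -/
noncomputable def Scheduler.var (σ : M.Scheduler) (X : M.Path → ℝ) : ℝ≥0∞ := evariance X σ.Pr

/-- The infimum of the expected value over all schedulers. -/
noncomputable def expMin (M : MDP S Act) (X : M.Path → ℝ) : ℝ := ⨅ σ : M.Scheduler, σ.expect X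

/-- The supremum of the expected value over all schedulers. -/
noncomputable def expMax (M : MDP S Act) (X : M.Path → ℝ) : ℝ := ⨆ σ : M.Scheduler, σ.expect X

/-- The maximal variance. -/
noncomputable def varMax (M : MDP S Act) (X : M.Path → ℝ) : ℝ≥0∞ := ⨆ σ : M.Scheduler, σ.var X

end Quantities

section Product

variable {S Act S' Act' : Type*} [Fintype S] [Fintype S']

/-- The synchronous product of two MDPs. -/
def prod (M : MDP S Act) (N : MDP S' Act') : MDP (S × S') (Act × Act') where
  P p a q := M.P p.1 a.1 q.1 * N.P p.2 a.2 q.2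
  init := (M.init, N.init)
  P_mem p a q := ⟨mul_nonneg (M.P_mem _ _ _).1 (N.P_mem _ _ _).1,
    mul_le_one₀ (M.P_mem _ _ _).2 (N.P_mem _ _ _).1 (N.P_mem _ _ _).2⟩
  P_sum p a := by
    rw [Fintype.sum_prod_type, ← Finset.sum_mul_sum]
    rcases M.P_sum p.1 a.1 with h | h <;> rcases N.P_sum p.2 a.2 with h' | h' <;> simp [h, h']
  exists_enabled p := by
    obtain ⟨α, hα⟩ := M.exists_enabled p.1
    obtain ⟨β, hβ⟩ := N.exists_enabled p.2
    refine ⟨(α, β), ?_⟩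
    rw [Fintype.sum_prod_type, ← Finset.sum_mul_sum, hα, hβ, mul_one]

variable {M : MDP S Act} {N : MDP S' Act'}

theorem prod_P_pos {p q : S × S'} {a : Act × Act'} (h : 0 < (M.prod N).P p a q) :
    0 < M.P p.1 a.1 q.1 ∧ 0 < N.P p.2 a.2 q.2 := by
  have h0 : M.P p.1 a.1 q.1 * N.P p.2 a.2 q.2 ≠ 0 := h.ne'
  exact ⟨lt_of_le_of_ne (M.P_mem _ _ _).1 (left_ne_zero_of_mul h0).symm,
    lt_of_le_of_ne (N.P_mem _ _ _).1 (right_ne_zero_of_mul h0).symm⟩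

/-- Projection of a finite path of the product to the first component. -/
def FinPath.fst {n : ℕ} (π : (M.prod N).FinPath n) : M.FinPath n :=
  ⟨fun i => (π.state i).1, fun i => (π.act i).1, fun i => (prod_P_pos (π.valid i)).1⟩

/-- Projection of a finite path of the product to the second component. -/
def FinPath.snd {n : ℕ} (π : (M.prod N).FinPath n) : N.FinPath n :=
  ⟨fun i => (π.state i).2, fun i => (π.act i).2, fun i => (prod_P_pos (π.valid i)).2⟩

/-- Projection of an infinite path of the product to the first component. -/
def Path.fst (ρ : (M.prod N).Path) : M.Path :=
  ⟨fun i => (ρ.state i).1, fun i => (ρ.act i).1, fun i => (prod_P_pos (ρ.valid i)).1⟩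

/-- Projection of an infinite path of the product to the second component. -/
def Path.snd (ρ : (M.prod N).Path) : N.Path :=
  ⟨fun i => (ρ.state i).2, fun i => (ρ.act i).2, fun i => (prod_P_pos (ρ.valid i)).2⟩

variable [Fintype Act] [Fintype Act']

/-- The product scheduler: the two components are scheduled independently. -/
def Scheduler.prod (σ : M.Scheduler) (τ : N.Scheduler) : (M.prod N).Scheduler where
  prob π a := σ.prob π.fst a.1 * τ.prob π.snd a.2
  nonneg π a := mul_nonneg (σ.nonneg _ _) (τ.nonneg _ _)
  sum_one π := by
    rw [Fintype.sum_prod_type, ← Finset.sum_mul_sum, σ.sum_one, τ.sum_one, mul_one]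
  enabled π a h := by
    by_cases h1 : M.Enabled π.fst.last a.1
    · by_cases h2 : N.Enabled π.snd.last a.2
      · refine absurd ?_ h
        change ∑ q : S × S', M.P π.fst.last a.1 q.1 * N.P π.snd.last a.2 q.2 = 1
        rw [Fintype.sum_prod_type, ← Finset.sum_mul_sum, h1, h2, mul_one]
      · rw [τ.enabled _ _ h2, mul_zero]
    · rw [σ.enabled _ _ h1, zero_mul]

end Product

section Demonic

variable {S Act : Type*} [Fintype S] [Fintype Act] {M : MDP S Act}

/-- `V^{σ,τ}_M(X) = ½ · E^{σ⊗τ}_{M⊗M}((X₁ - X₂)²)`, as a value in `[0, ∞]`. -/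
noncomputable def Scheduler.varPair (σ τ : M.Scheduler) (X : M.Path → ℝ) : ℝ≥0∞ :=
  (1 / 2) * ∫⁻ ρ, ENNReal.ofReal ((X ρ.fst - X ρ.snd) ^ 2) ∂(σ.prod τ).Pr

/-- The demonic variance. -/
noncomputable def varDem (M : MDP S Act) (X : M.Path → ℝ) : ℝ≥0∞ :=
  ⨆ (σ : M.Scheduler) (τ : M.Scheduler), σ.varPair τ X

/-- The non-determinism score `(V^dem - V^max) / V^max`, computed in `[0, ∞]`. When
`0 < V^max < ∞` and the score is `1`, the subtraction cannot be a truncated one. -/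
noncomputable def NDS (M : MDP S Act) (X : M.Path → ℝ) : ℝ≥0∞ :=
  (M.varDem X - M.varMax X) / M.varMax X

end Demonic

end MDP

/-! Write V for the maximal variance and, for schedulers σ and τ, let a be the sum of their
variances and d the difference of their expectations. Two quadratic identities drive the proof. A
fair coin tossed at the start to choose between σ and τ is itself realized by a scheduler
(`Scheduler.mix`), whose path measure is the average of the two (`Scheduler.Pr_mix`). Its variance
is a/2 + d²/4, and hence this quantity is at most V. In particular |d| ≤ 2√V for every pair. Under
the product scheduler the two components are independent (`Scheduler.Pr_prod`), so the pair variance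
is a/2 + d²/2 (`Scheduler.varPair_eq`). This is twice the variance of the mixture minus a/2, hence
at most 2V - a/2. A score of 1 means that the demonic variance is 2V. A pair that comes close to 2V
must therefore have small a and |d| close to 2√V. Since no pair has expectations further apart than
2√V, its two members nearly minimize and nearly maximize the expectation (`near_extremal`). This
gives the first claim, and the second is the case of zero error. The third claim follows by
compactness. Near-optimal schedulers make X converge in mean square to the extremal value. Along an
ultrafilter they converge pointwise to a scheduler, and so do the probabilities of cylinders. By
continuity, a path with X different from the extremal value has a cylinder on which X stays away
from it, and such a cylinder has mass 0 in the limit. -/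

namespace MDP

/-! ### Topology of path space, and independence in the synchronous product -/

section PathSpace

variable {S Act S' Act' : Type*} [Fintype S] [Fintype S'] {M : MDP S Act} {N : MDP S' Act'}

theorem FinPath.measurableSet_cyl {n : ℕ} (π : M.FinPath n) : MeasurableSet π.cyl :=
  MeasurableSpace.measurableSet_generateFrom ⟨n, π, rfl⟩

theorem Path.cyl_take_antitone (ρ : M.Path) {m n : ℕ} (h : m ≤ n) :
    (ρ.take n).cyl ⊆ (ρ.take m).cyl := by
  intro ρ₂ h₂
  have h₃ : ρ₂.take n = ρ.take n := h₂
  exact congrArg (fun π : M.FinPath n => π.take h) h₃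

/-- The generating sets that contain `ρ` are exactly the cylinders of its prefixes, and these are
nested, so no finite intersections are needed. -/
theorem Path.nhds_hasBasis (ρ : M.Path) :
    (nhds ρ).HasBasis (fun _ : ℕ => True) fun n => (ρ.take n).cyl := by
  have h : nhds ρ = ⨅ n : ℕ, Filter.principal (ρ.take n).cyl := by
    rw [TopologicalSpace.nhds_generateFrom]
    refine le_antisymm (le_iInf fun n => ?_) (le_iInf₂ ?_)
    · exact iInf₂_le _ ⟨rfl, n, ρ.take n, rfl⟩
    · rintro _ ⟨hρ, n, π, rfl⟩
      have h₁ : ρ.take n = π := hρ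
      rw [← h₁]
      exact iInf_le _ n
  rw [h]
  exact Filter.hasBasis_iInf_principal
    (directed_of_isDirected_le fun _ _ h => ρ.cyl_take_antitone h)

/-- The path of the synchronous product with given components. -/
def Path.zip (p : M.Path × N.Path) : (M.prod N).Path where
  state i := (p.1.state i, p.2.state i)
  act i := (p.1.act i, p.2.act i)
  valid i := mul_pos (p.1.valid i) (p.2.valid i)

theorem Path.zip_preimage_cyl {n : ℕ} (π : (M.prod N).FinPath n) :
    Path.zip ⁻¹' π.cyl = π.fst.cyl ×ˢ π.snd.cyl := by
  ext ⟨ρ, ρ'⟩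
  constructor
  · intro h
    have h : (Path.zip (ρ, ρ')).take n = π := h
    subst h
    exact ⟨rfl, rfl⟩
  · rintro ⟨h₁, h₂⟩
    have h₁ : ρ.take n = π.fst := h₁
    have h₂ : ρ'.take n = π.snd := h₂
    refine FinPath.ext (funext fun i => Prod.ext ?_ ?_) (funext fun i => Prod.ext ?_ ?_)
    · exact congrFun (congrArg FinPath.state h₁) i
    · exact congrFun (congrArg FinPath.state h₂) i
    · exact congrFun (congrArg FinPath.act h₁) i
    · exact congrFun (congrArg FinPath.act h₂) i

theorem Path.measurable_zip : Measurable (Path.zip : M.Path × N.Path → (M.prod N).Path) := by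
  refine measurable_generateFrom ?_
  rintro _ ⟨n, π, rfl⟩
  rw [Path.zip_preimage_cyl]
  exact π.fst.measurableSet_cyl.prod π.snd.measurableSet_cyl

variable [Fintype Act] [Fintype Act']

/-- The preimage of a cylinder is not a cylinder but the union of those of all lifts of the finite
path. There are finitely many lifts, as both action sets are finite. -/
theorem Path.measurable_fst : Measurable (Path.fst : (M.prod N).Path → M.Path) := by
  refine measurable_generateFrom ?_
  rintro _ ⟨n, π, rfl⟩
  have h : Path.fst ⁻¹' π.cyl = ⋃ π₂ : {π₂ : (M.prod N).FinPath n // π₂.fst = π}, π₂.1.cyl := by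
    ext ρ
    rw [Set.mem_iUnion]
    constructor
    · intro h
      exact ⟨⟨ρ.take n, h⟩, rfl⟩
    · rintro ⟨⟨π₂, rfl⟩, h⟩
      exact congrArg FinPath.fst (show ρ.take n = π₂ from h)
  rw [h]
  exact MeasurableSet.iUnion fun π₂ => π₂.1.measurableSet_cyl

theorem Path.measurable_snd : Measurable (Path.snd : (M.prod N).Path → N.Path) := by
  refine measurable_generateFrom ?_
  rintro _ ⟨n, π, rfl⟩
  have h : Path.snd ⁻¹' π.cyl = ⋃ π₂ : {π₂ : (M.prod N).FinPath n // π₂.snd = π}, π₂.1.cyl := by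
    ext ρ
    rw [Set.mem_iUnion]
    constructor
    · intro h
      exact ⟨⟨ρ.take n, h⟩, rfl⟩
    · rintro ⟨⟨π₂, rfl⟩, h⟩
      exact congrArg FinPath.snd (show ρ.take n = π₂ from h)
  rw [h]
  exact MeasurableSet.iUnion fun π₂ => π₂.1.measurableSet_cyl

theorem Scheduler.pathProb_prod (σ : M.Scheduler) (τ : N.Scheduler) {n : ℕ}
    (π : (M.prod N).FinPath n) :
    (σ.prod τ).pathProb π = σ.pathProb π.fst * τ.pathProb π.snd := by
  simp only [Scheduler.pathProb]
  rw [← Finset.prod_mul_distrib]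
  refine Finset.prod_congr rfl fun i _ => ?_
  have h₁ : (σ.prod τ).prob (π.take i.isLt.le) (π.act i) =
      σ.prob (π.fst.take i.isLt.le) (π.fst.act i) *
        τ.prob (π.snd.take i.isLt.le) (π.snd.act i) := rfl
  have h₂ : (M.prod N).P (π.state i.castSucc) (π.act i) (π.state i.succ) =
      M.P (π.fst.state i.castSucc) (π.fst.act i) (π.fst.state i.succ) *
        N.P (π.snd.state i.castSucc) (π.snd.act i) (π.snd.state i.succ) := rfl
  rw [h₁, h₂]
  push_cast
  ring

/-- Under a product scheduler the two components of a path are independent. -/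
theorem Scheduler.Pr_prod (σ : M.Scheduler) (τ : N.Scheduler) :
    (σ.prod τ).Pr = (σ.Pr.prod τ.Pr).map Path.zip := by
  have : IsProbabilityMeasure ((σ.Pr.prod τ.Pr).map (Path.zip (M := M) (N := N))) :=
    Measure.isProbabilityMeasure_map Path.measurable_zip.aemeasurable
  refine (σ.prod τ).measure_unique _ _ (fun n π h => (σ.prod τ).Pr_cyl π h) fun n π h => ?_
  rw [Measure.map_apply Path.measurable_zip π.measurableSet_cyl, Path.zip_preimage_cyl,
    Measure.prod_prod, σ.Pr_cyl _ (congrArg Prod.fst h), τ.Pr_cyl _ (congrArg Prod.snd h),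
    σ.pathProb_prod, ENNReal.ofReal_mul (σ.pathProb_nonneg _)]

end PathSpace

/-! ### Mixing two schedulers, and the two variance identities -/

section Mixture

variable {S Act : Type*} [Fintype S] [Fintype Act] {M : MDP S Act}

/-- The scheduler that follows `σ` or `τ` with probability `1/2` each. -/
noncomputable def Scheduler.mix (σ τ : M.Scheduler) : M.Scheduler where
  prob π α :=
    open Classical in
    -- The weights are the posterior probabilities, given the history, that σ or τ was chosen at the
    -- start. On histories that neither scheduler realizes any distribution would do.
    if σ.pathProb π + τ.pathProb π = 0 then σ.prob π α else
      (σ.pathProb π * σ.prob π α + τ.pathProb π * τ.prob π α) / (σ.pathProb π + τ.pathProb π)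
  nonneg π α := by
    have := σ.pathProb_nonneg π
    have := τ.pathProb_nonneg π
    have := σ.nonneg π α
    have := τ.nonneg π α
    split_ifs <;> positivity
  sum_one π := by
    split_ifs with h
    · exact σ.sum_one π
    · rw [← Finset.sum_div, Finset.sum_add_distrib, ← Finset.mul_sum, ← Finset.mul_sum,
        σ.sum_one, τ.sum_one, mul_one, mul_one, div_self h]
  enabled π α h := by
    simp [σ.enabled π α h, τ.enabled π α h]

/-- In the inductive step the normalizing denominator of the mixture cancels against the probability
of the prefix. -/
theorem Scheduler.pathProb_mix (σ τ : M.Scheduler) {n : ℕ} (π : M.FinPath n) :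
    (σ.mix τ).pathProb π = (σ.pathProb π + τ.pathProb π) / 2 := by
  induction n with
  | zero => norm_num [Scheduler.pathProb]
  | succ n ih =>
    rw [Scheduler.pathProb_succ, ih, σ.pathProb_succ, τ.pathProb_succ]
    set ρ := π.take n.le_succ
    have hσ := σ.pathProb_nonneg ρ
    have hτ := τ.pathProb_nonneg ρ
    by_cases h : σ.pathProb ρ + τ.pathProb ρ = 0
    · rw [h, show σ.pathProb ρ = 0 by linarith, show τ.pathProb ρ = 0 by linarith]
      ring
    · simp only [Scheduler.mix, h, if_false]
      field_simp

theorem Scheduler.Pr_mix (σ τ : M.Scheduler) :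
    (σ.mix τ).Pr = (2⁻¹ : ℝ≥0∞) • σ.Pr + (2⁻¹ : ℝ≥0∞) • τ.Pr := by
  have : IsProbabilityMeasure ((2⁻¹ : ℝ≥0∞) • σ.Pr + (2⁻¹ : ℝ≥0∞) • τ.Pr) :=
    ⟨by simp [ENNReal.inv_two_add_inv_two]⟩
  refine (σ.mix τ).measure_unique _ _ (fun n π h => (σ.mix τ).Pr_cyl π h) fun n π h => ?_
  have h₂ : (2⁻¹ : ℝ≥0∞) = ENNReal.ofReal 2⁻¹ := by
    rw [ENNReal.ofReal_inv_of_pos two_pos, ENNReal.ofReal_ofNat]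
  simp only [Measure.add_apply, Measure.smul_apply, smul_eq_mul]
  rw [σ.Pr_cyl π h, τ.Pr_cyl π h, ← mul_add,
    ← ENNReal.ofReal_add (σ.pathProb_nonneg π) (τ.pathProb_nonneg π), h₂,
    ← ENNReal.ofReal_mul (by norm_num), σ.pathProb_mix]
  congr 1
  ring

theorem Scheduler.integral_mix (σ τ : M.Scheduler) {f : M.Path → ℝ} (hσ : Integrable f σ.Pr)
    (hτ : Integrable f τ.Pr) :
    ∫ ρ, f ρ ∂(σ.mix τ).Pr = (∫ ρ, f ρ ∂σ.Pr + ∫ ρ, f ρ ∂τ.Pr) / 2 := by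
  rw [Scheduler.Pr_mix, integral_add_measure (hσ.smul_measure (by simp))
    (hτ.smul_measure (by simp)), integral_smul_measure, integral_smul_measure]
  simp only [ENNReal.toReal_inv, ENNReal.toReal_ofNat, smul_eq_mul]
  ring

/-- Law of total variance for a fair coin: the mean of the variances plus the variance of the
conditional mean. -/
theorem Scheduler.variance_mix (σ τ : M.Scheduler) {X : M.Path → ℝ} (hσ : MemLp X 2 σ.Pr)
    (hτ : MemLp X 2 τ.Pr) (h : MemLp X 2 (σ.mix τ).Pr) :
    variance X (σ.mix τ).Pr = (variance X σ.Pr + variance X τ.Pr) / 2 +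
      (σ.expect X - τ.expect X) ^ 2 / 4 := by
  rw [variance_eq_sub h, variance_eq_sub hσ, variance_eq_sub hτ]
  simp only [Pi.pow_apply]
  rw [σ.integral_mix τ hσ.integrable_sq hτ.integrable_sq,
    σ.integral_mix τ (hσ.integrable one_le_two) (hτ.integrable one_le_two)]
  simp only [Scheduler.expect]
  ring

/-- Expand the square; by independence the cross term is the product of the two expectations. -/
theorem Scheduler.varPair_eq (σ τ : M.Scheduler) {X : M.Path → ℝ} (hX : Measurable X)
    (hσ : MemLp X 2 σ.Pr) (hτ : MemLp X 2 τ.Pr) :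
    σ.varPair τ X = ENNReal.ofReal ((variance X σ.Pr + variance X τ.Pr +
      (σ.expect X - τ.expect X) ^ 2) / 2) := by
  have hm : Measurable fun ρ : (M.prod M).Path => ENNReal.ofReal ((X ρ.fst - X ρ.snd) ^ 2) :=
    (((hX.comp Path.measurable_fst).sub (hX.comp Path.measurable_snd)).pow_const 2).ennreal_ofReal
  have h₁ : Integrable (fun p : M.Path × M.Path => X p.1 ^ 2) (σ.Pr.prod τ.Pr) :=
    hσ.integrable_sq.comp_fst τ.Pr
  have h₂ : Integrable (fun p : M.Path × M.Path => X p.2 ^ 2) (σ.Pr.prod τ.Pr) :=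
    hτ.integrable_sq.comp_snd σ.Pr
  have h₃ : Integrable (fun p : M.Path × M.Path => X p.1 * X p.2) (σ.Pr.prod τ.Pr) :=
    (hσ.integrable one_le_two).mul_prod (hτ.integrable one_le_two)
  have h₄ : (fun p : M.Path × M.Path => (X p.1 - X p.2) ^ 2) =
      fun p => X p.1 ^ 2 + X p.2 ^ 2 - 2 * (X p.1 * X p.2) := by
    ext p
    ring
  have h₁₂ : Integrable (fun p : M.Path × M.Path => X p.1 ^ 2 + X p.2 ^ 2) (σ.Pr.prod τ.Pr) :=
    h₁.add h₂
  have h₅ : Integrable (fun p : M.Path × M.Path => (X p.1 - X p.2) ^ 2) (σ.Pr.prod τ.Pr) := by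
    rw [h₄]
    exact h₁₂.sub (h₃.const_mul 2)
  have h₆ : ∫ p, (X p.1 - X p.2) ^ 2 ∂(σ.Pr.prod τ.Pr) = variance X σ.Pr + variance X τ.Pr +
      (σ.expect X - τ.expect X) ^ 2 := by
    rw [h₄, integral_sub h₁₂ (h₃.const_mul 2), integral_add h₁ h₂, integral_const_mul,
      integral_prod_mul, integral_fun_fst (fun ρ => X ρ ^ 2), integral_fun_snd (fun ρ => X ρ ^ 2),
      variance_eq_sub hσ, variance_eq_sub hτ]
    simp only [Scheduler.expect, probReal_univ, one_smul, Pi.pow_apply]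
    ring
  rw [Scheduler.varPair, Scheduler.Pr_prod, lintegral_map hm Path.measurable_zip]
  -- The projections of `Path.zip p` are definitionally `p.1` and `p.2`.
  change 1 / 2 * ∫⁻ p : M.Path × M.Path, ENNReal.ofReal ((X p.1 - X p.2) ^ 2) ∂_ = _
  rw [← ofReal_integral_eq_lintegral_ofReal h₅ (Filter.Eventually.of_forall fun p => sq_nonneg _),
    h₆, ENNReal.ofReal_div_of_pos two_pos, ENNReal.ofReal_ofNat, one_div, ENNReal.div_eq_inv_mul]

end Mixture

/-! ### Compactness of the set of schedulers -/

section Compactness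

variable {S Act : Type*} [Fintype S] [Fintype Act] {M : MDP S Act}

theorem Scheduler.prob_le_one (σ : M.Scheduler) {n : ℕ} (π : M.FinPath n) (α : Act) :
    σ.prob π α ≤ 1 := by
  rw [← σ.sum_one π]
  exact Finset.single_le_sum (fun β _ => σ.nonneg π β) (Finset.mem_univ α)

/-- Along an ultrafilter every family of schedulers converges pointwise. -/
theorem Scheduler.exists_tendsto {ι : Type*} (U : Ultrafilter ι) (s : ι → M.Scheduler) :
    ∃ σ : M.Scheduler, ∀ (n : ℕ) (π : M.FinPath n) (α : Act),
      Filter.Tendsto (fun i => (s i).prob π α) U (nhds (σ.prob π α)) := by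
  have h : ∀ (n : ℕ) (π : M.FinPath n) (α : Act), ∃ x : ℝ,
      Filter.Tendsto (fun i => (s i).prob π α) U (nhds x) := by
    intro n π α
    -- An ultrafilter yields a limit in the unit interval at all finite paths at once, without
    -- extracting diagonal subsequences. The scheduler axioms are closed conditions and pass to the
    -- limit.
    obtain ⟨x, -, hx⟩ := (isCompact_Icc (a := (0 : ℝ)) (b := 1)).ultrafilter_le_nhds
      (U.map fun i => (s i).prob π α) (Filter.le_principal_iff.2 (Filter.mem_map.2
        (Filter.univ_mem' fun i => ⟨(s i).nonneg π α, (s i).prob_le_one π α⟩)))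
    exact ⟨x, hx⟩
  choose p hp using h
  refine ⟨⟨fun {n} π α => p n π α, fun {n} π α => ?_, fun {n} π => ?_, fun {n} π α hα => ?_⟩, hp⟩
  · exact ge_of_tendsto' (hp n π α) fun i => (s i).nonneg π α
  · refine tendsto_nhds_unique (tendsto_finsetSum Finset.univ fun α _ => hp n π α) ?_
    simp only [Scheduler.sum_one]
    exact tendsto_const_nhds
  · refine tendsto_nhds_unique (hp n π α) ?_
    simp only [fun i => (s i).enabled π α hα]
    exact tendsto_const_nhds

/-- The probability of a cylinder is a finite product in the values of the scheduler, hence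
continuous under pointwise convergence. -/
theorem Scheduler.tendsto_Pr_cyl {ι : Type*} {l : Filter ι} {s : ι → M.Scheduler}
    {σ : M.Scheduler} (h : ∀ (n : ℕ) (π : M.FinPath n) (α : Act),
      Filter.Tendsto (fun i => (s i).prob π α) l (nhds (σ.prob π α)))
    {n : ℕ} (π : M.FinPath n) (hπ : π.state 0 = M.init) :
    Filter.Tendsto (fun i => (s i).Pr π.cyl) l (nhds (σ.Pr π.cyl)) := by
  simp only [fun τ : M.Scheduler => τ.Pr_cyl π hπ]
  refine ENNReal.tendsto_ofReal (tendsto_finsetProd Finset.univ fun i _ => ?_)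
  exact (h _ _ _).mul_const _

theorem Scheduler.Pr_init (σ : M.Scheduler) : ∀ᵐ ρ ∂σ.Pr, ρ.state 0 = M.init := by
  let e : M.FinPath 0 := ⟨fun _ => M.init, fun i => i.elim0, fun i => i.elim0⟩
  have h : σ.Pr e.cyl = 1 := by
    rw [σ.Pr_cyl e rfl]
    simp [Scheduler.pathProb]
  filter_upwards [(mem_ae_iff_prob_eq_one e.measurableSet_cyl).2 h] with ρ hρ
  exact congrFun (congrArg FinPath.state (show ρ.take 0 = e from hρ)) 0

/-- If a continuous function is arbitrarily close to a constant in mean square, then some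
scheduler makes it almost surely equal to that constant. -/
theorem Scheduler.exists_Pr_eq_one {X : M.Path → ℝ} (hX : Continuous X) (hm : Measurable X)
    {a : ℝ} {s : ℕ → M.Scheduler}
    (hs : Filter.Tendsto (fun k => ∫⁻ ρ, ENNReal.ofReal ((X ρ - a) ^ 2) ∂(s k).Pr) Filter.atTop
      (nhds 0)) :
    ∃ σ : M.Scheduler, σ.Pr {ρ | X ρ = a} = 1 := by
  obtain ⟨σ, hσ⟩ := Scheduler.exists_tendsto (Filter.hyperfilter ℕ) s
  refine ⟨σ, ?_⟩
  have hU : Filter.Tendsto (fun k => ∫⁻ ρ, ENNReal.ofReal ((X ρ - a) ^ 2) ∂(s k).Pr)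
      (Filter.hyperfilter ℕ) (nhds 0) := hs.mono_left Nat.hyperfilter_le_atTop
  have hmf : Measurable fun ρ => ENNReal.ofReal ((X ρ - a) ^ 2) :=
    ((hm.sub_const a).pow_const 2).ennreal_ofReal
  -- By Markov's inequality, c times the mass of the cylinder under `s k` is at most the mean square
  -- error, which tends to 0.
  have key : ∀ (n : ℕ) (π : M.FinPath n) (c : ℝ), π.state 0 = M.init → 0 < c →
      (∀ ρ ∈ π.cyl, c ≤ (X ρ - a) ^ 2) → σ.Pr π.cyl = 0 := by
    intro n π c hπ hc h
    have h₁ : ∀ k, ENNReal.ofReal c * (s k).Pr π.cyl ≤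
        ∫⁻ ρ, ENNReal.ofReal ((X ρ - a) ^ 2) ∂(s k).Pr := fun k =>
      (mul_le_mul_right (measure_mono fun ρ hρ => ENNReal.ofReal_le_ofReal (h ρ hρ)) _).trans
        (mul_meas_ge_le_lintegral hmf _)
    have h₂ := le_of_tendsto_of_tendsto' (ENNReal.Tendsto.const_mul
      (Scheduler.tendsto_Pr_cyl hσ π hπ) (Or.inr ENNReal.ofReal_ne_top)) hU h₁
    exact (mul_eq_zero.1 (le_antisymm h₂ zero_le)).resolve_left (ENNReal.ofReal_pos.2 hc).ne'
  -- There are only countably many cylinders, so almost every path avoids all null ones.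
  have hnull : ∀ᵐ ρ ∂σ.Pr, ∀ (n : ℕ) (π : M.FinPath n), ρ ∈ π.cyl → σ.Pr π.cyl ≠ 0 := by
    refine ae_all_iff.2 fun n => ae_all_iff.2 fun π => ?_
    by_cases h : σ.Pr π.cyl = 0
    · filter_upwards [measure_eq_zero_iff_ae_notMem.1 h] with ρ hρ hρ'
      exact absurd hρ' hρ
    · exact Filter.Eventually.of_forall fun _ _ => h
  refine (mem_ae_iff_prob_eq_one (hm (measurableSet_singleton a))).1 ?_
  filter_upwards [hnull, σ.Pr_init] with ρ hρ hi
  by_contra hne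
  have hpos : 0 < (X ρ - a) ^ 2 := sq_pos_of_ne_zero (sub_ne_zero.2 hne)
  have hc : Continuous fun ρ => (X ρ - a) ^ 2 := (hX.sub continuous_const).pow 2
  -- On the cylinder of some prefix of `ρ`, the squared distance to `a` stays above half its value
  -- at `ρ`, so `key` makes this cylinder null, contrary to `hρ`.
  obtain ⟨n, -, hn⟩ := ρ.nhds_hasBasis.mem_iff.1
    (hc.continuousAt.preimage_mem_nhds (Ici_mem_nhds (half_lt_self hpos)))
  exact hρ n (ρ.take n) rfl (key n (ρ.take n) _ hi (half_pos hpos) fun ρ₂ h₂ => hn h₂)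

end Compactness

/-! ### Consequences of a score equal to 1 -/

section Score

variable {S Act : Type*} [Fintype S] [Fintype Act] {M : MDP S Act} {X : M.Path → ℝ}

theorem memLp_of_varMax_lt_top (hX : Measurable X) (h : M.varMax X < ∞) (σ : M.Scheduler) :
    MemLp X 2 σ.Pr :=
  (evariance_lt_top_iff_memLp hX.aestronglyMeasurable).1 ((le_iSup _ σ).trans_lt h)

theorem variance_le_varMax (h : M.varMax X < ∞) (σ : M.Scheduler) :
    variance X σ.Pr ≤ (M.varMax X).toReal :=
  ENNReal.toReal_mono h.ne (le_iSup (fun σ : M.Scheduler => σ.var X) σ)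

/-- The left side is the variance of the mixture of the two schedulers. -/
theorem variance_add_le_varMax (hX : Measurable X) (h : M.varMax X < ∞) (σ τ : M.Scheduler) :
    (variance X σ.Pr + variance X τ.Pr) / 2 + (σ.expect X - τ.expect X) ^ 2 / 4 ≤
      (M.varMax X).toReal := by
  rw [← σ.variance_mix τ (memLp_of_varMax_lt_top hX h σ) (memLp_of_varMax_lt_top hX h τ)
    (memLp_of_varMax_lt_top hX h _)]
  exact variance_le_varMax h _

theorem expect_sub_le (hX : Measurable X) (h : M.varMax X < ∞) (σ τ : M.Scheduler) :
    τ.expect X - σ.expect X ≤ 2 * √(M.varMax X).toReal := by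
  have h₁ := variance_add_le_varMax hX h σ τ
  have h₂ := variance_nonneg X σ.Pr
  have h₃ := variance_nonneg X τ.Pr
  refine abs_le_of_sq_le_sq' ?_ (by positivity) |>.2
  rw [mul_pow, Real.sq_sqrt ENNReal.toReal_nonneg]
  linarith [sub_sq_comm (σ.expect X) (τ.expect X)]

theorem varDem_eq_of_NDS_eq_one (h : M.varMax X < ∞) (hpos : 0 < M.varMax X)
    (hN : M.NDS X = 1) : M.varDem X = ENNReal.ofReal (2 * (M.varMax X).toReal) := by
  have h₁ : M.varDem X - M.varMax X = M.varMax X := by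
    rwa [NDS, ENNReal.div_eq_one_iff hpos.ne' h.ne] at hN
  -- Excludes truncation of the subtraction, which would make the difference 0 and contradict the
  -- positivity of the maximal variance.
  have h₂ : M.varMax X ≤ M.varDem X := by
    by_contra h₃
    rw [tsub_eq_zero_of_le (not_le.1 h₃).le] at h₁
    exact hpos.ne h₁
  rw [ENNReal.ofReal_mul two_pos.le, ENNReal.ofReal_toReal h.ne, ENNReal.ofReal_ofNat, two_mul,
    ← tsub_add_cancel_of_le h₂, h₁]

/-- A pair of schedulers whose variance nearly attains twice the maximal variance consists, up to
order, of a nearly minimizing and a nearly maximizing scheduler of small variance. -/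
theorem near_extremal (hX : Measurable X) (h : M.varMax X < ∞) {σ τ : M.Scheduler} {δ ε : ℝ}
    (hε : 0 ≤ ε) (hδ : 2 * δ ≤ ε * √(M.varMax X).toReal) (hle : σ.expect X ≤ τ.expect X)
    (hp : 2 * (M.varMax X).toReal - δ ≤
      (variance X σ.Pr + variance X τ.Pr + (σ.expect X - τ.expect X) ^ 2) / 2) :
    (variance X σ.Pr ≤ 2 * δ ∧ ∀ σ' : M.Scheduler, σ.expect X - ε ≤ σ'.expect X) ∧
      variance X τ.Pr ≤ 2 * δ ∧ ∀ τ' : M.Scheduler, τ'.expect X ≤ τ.expect X + ε := by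
  have h₁ := variance_add_le_varMax hX h σ τ
  have h₂ := variance_nonneg X σ.Pr
  have h₃ := variance_nonneg X τ.Pr
  -- With V the maximal variance, `hp` and `h₁` give (Eτ - Eσ)² ≥ 4V - 4δ ≥ 4V - 2ε√V. This is at
  -- least (2√V - ε)² as soon as ε ≤ 2√V; for larger ε the claim is trivial, its left side being
  -- nonpositive.
  have hd : 2 * √(M.varMax X).toReal - ε ≤ τ.expect X - σ.expect X := by
    rcases le_or_gt (2 * √(M.varMax X).toReal) ε with h₄ | h₄
    · linarith
    · refine le_of_sq_le_sq ?_ (sub_nonneg.2 hle)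
      have h₅ := Real.sq_sqrt (ENNReal.toReal_nonneg (a := M.varMax X))
      nlinarith
  refine ⟨⟨by linarith, fun σ' => ?_⟩, by linarith, fun τ' => ?_⟩
  -- Eτ exceeds Eσ' by at most 2√V but exceeds Eσ by at least 2√V - ε, so Eσ' ≥ Eσ - ε.
  · linarith [expect_sub_le hX h σ' τ]
  · linarith [expect_sub_le hX h σ τ']

theorem exists_near_extremal (hX : Measurable X) (h : M.varMax X < ∞) (hpos : 0 < M.varMax X)
    (hN : M.NDS X = 1) {ε : ℝ} (hε : 0 < ε) :
    ∃ σ τ : M.Scheduler,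
      (variance X σ.Pr ≤ ε ∧ ∀ σ' : M.Scheduler, σ.expect X - ε ≤ σ'.expect X) ∧
        variance X τ.Pr ≤ ε ∧ ∀ τ' : M.Scheduler, τ'.expect X ≤ τ.expect X + ε := by
  have hV : 0 < (M.varMax X).toReal := ENNReal.toReal_pos hpos.ne' h.ne
  -- The first bound controls the variances, the second is what `near_extremal` needs for the
  -- expectations.
  obtain ⟨δ, hδ, hδ₁, hδ₂⟩ : ∃ δ > 0, 2 * δ ≤ ε ∧ 2 * δ ≤ ε * √(M.varMax X).toReal :=
    ⟨min (ε / 2) (ε * √(M.varMax X).toReal / 2), by positivity,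
      by linarith [min_le_left (ε / 2) (ε * √(M.varMax X).toReal / 2)],
      by linarith [min_le_right (ε / 2) (ε * √(M.varMax X).toReal / 2)]⟩
  have hlt : ENNReal.ofReal (2 * (M.varMax X).toReal - δ) < M.varDem X := by
    rw [varDem_eq_of_NDS_eq_one h hpos hN, ENNReal.ofReal_lt_ofReal_iff (by positivity)]
    linarith
  obtain ⟨σ, hσ⟩ := lt_iSup_iff.1 hlt
  obtain ⟨τ, hτ⟩ := lt_iSup_iff.1 hσ
  rw [σ.varPair_eq τ hX (memLp_of_varMax_lt_top hX h σ) (memLp_of_varMax_lt_top hX h τ)] at hτ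
  have hp := (ENNReal.ofReal_lt_ofReal_iff'.1 hτ).1
  rcases le_total (σ.expect X) (τ.expect X) with hle | hle
  · obtain ⟨⟨a, b⟩, c, d⟩ := near_extremal hX h hε.le hδ₂ hle hp.le
    exact ⟨σ, τ, ⟨a.trans hδ₁, b⟩, c.trans hδ₁, d⟩
  · rw [add_comm (variance X σ.Pr), sub_sq_comm] at hp
    obtain ⟨⟨a, b⟩, c, d⟩ := near_extremal hX h hε.le hδ₂ hle hp.le
    exact ⟨τ, σ, ⟨a.trans hδ₁, b⟩, c.trans hδ₁, d⟩

theorem Scheduler.var_eq_ofReal_variance {σ : M.Scheduler} (h : MemLp X 2 σ.Pr) :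
    σ.var X = ENNReal.ofReal (variance X σ.Pr) :=
  h.ofReal_variance_eq.symm

theorem Scheduler.Pr_eq_expect_of_variance_eq_zero {σ : M.Scheduler} (hX : Measurable X)
    (h : MemLp X 2 σ.Pr) (h₀ : variance X σ.Pr = 0) : σ.Pr {ρ | X ρ = σ.expect X} = 1 := by
  refine (mem_ae_iff_prob_eq_one (hX (measurableSet_singleton _))).1 ?_
  refine (evariance_eq_zero_iff hX.aemeasurable).1 ?_
  rw [← h.ofReal_variance_eq, h₀, ENNReal.ofReal_zero]

/-- With zero error, `near_extremal` gives zero variances and expectations that are attained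
extrema, so X is almost surely equal to its extremal mean. -/
theorem extremal_of_varPair_eq (hX : Measurable X) (h : M.varMax X < ∞) {σ τ : M.Scheduler}
    (hle : σ.expect X ≤ τ.expect X)
    (hp : 2 * (M.varMax X).toReal ≤
      (variance X σ.Pr + variance X τ.Pr + (σ.expect X - τ.expect X) ^ 2) / 2) :
    σ.Pr {ρ | X ρ = M.expMin X} = 1 ∧ τ.Pr {ρ | X ρ = M.expMax X} = 1 := by
  obtain ⟨⟨h₁, h₂⟩, h₃, h₄⟩ := near_extremal (δ := 0) (ε := 0) hX h le_rfl (by simp) hle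
    (by linarith)
  simp only [sub_zero, add_zero, mul_zero] at h₁ h₂ h₃ h₄
  have hmin : M.expMin X = σ.expect X :=
    IsLeast.csInf_eq ⟨⟨σ, rfl⟩, by rintro _ ⟨σ', rfl⟩; exact h₂ σ'⟩
  have hmax : M.expMax X = τ.expect X :=
    IsGreatest.csSup_eq ⟨⟨τ, rfl⟩, by rintro _ ⟨τ', rfl⟩; exact h₄ τ'⟩
  rw [hmin, hmax]
  exact ⟨Scheduler.Pr_eq_expect_of_variance_eq_zero hX (memLp_of_varMax_lt_top hX h σ)
      (le_antisymm h₁ (variance_nonneg _ _)),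
    Scheduler.Pr_eq_expect_of_variance_eq_zero hX (memLp_of_varMax_lt_top hX h τ)
      (le_antisymm h₃ (variance_nonneg _ _))⟩

/-- The decomposition into variance and squared bias turns near-optimality with small variance into
mean square convergence to the extremal value. -/
theorem Scheduler.lintegral_sub_sq {σ : M.Scheduler} (h : MemLp X 2 σ.Pr) (a : ℝ) :
    ∫⁻ ρ, ENNReal.ofReal ((X ρ - a) ^ 2) ∂σ.Pr =
      ENNReal.ofReal (variance X σ.Pr + (σ.expect X - a) ^ 2) := by
  have h₁ : (fun ρ => (X ρ - a) ^ 2) = fun ρ => X ρ ^ 2 - 2 * a * X ρ + a ^ 2 := by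
    ext ρ
    ring
  have h₂ : Integrable (fun ρ => 2 * a * X ρ) σ.Pr := (h.integrable one_le_two).const_mul _
  have h₂' : Integrable (fun ρ => X ρ ^ 2 - 2 * a * X ρ) σ.Pr := h.integrable_sq.sub h₂
  have h₃ : Integrable (fun ρ => (X ρ - a) ^ 2) σ.Pr := by
    rw [h₁]
    exact h₂'.add (integrable_const _)
  rw [← ofReal_integral_eq_lintegral_ofReal h₃ (Filter.Eventually.of_forall fun _ => sq_nonneg _),
    h₁, integral_add h₂' (integrable_const _),
    integral_sub h.integrable_sq h₂, integral_const_mul, variance_eq_sub h]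
  congr 1
  simp only [Scheduler.expect, integral_const, probReal_univ, one_smul, Pi.pow_apply]
  ring

theorem tendsto_lintegral_sub_sq {s : ℕ → M.Scheduler} {a : ℝ} (hL : ∀ k, MemLp X 2 (s k).Pr)
    (hv : ∀ k : ℕ, variance X (s k).Pr ≤ 1 / ((k : ℝ) + 1))
    (he : ∀ k : ℕ, |(s k).expect X - a| ≤ 1 / ((k : ℝ) + 1)) :
    Filter.Tendsto (fun k => ∫⁻ ρ, ENNReal.ofReal ((X ρ - a) ^ 2) ∂(s k).Pr) Filter.atTop
      (nhds 0) := by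
  simp only [fun k => Scheduler.lintegral_sub_sq (hL k)]
  rw [← ENNReal.ofReal_zero]
  refine ENNReal.tendsto_ofReal ?_
  have ht := tendsto_one_div_add_atTop_nhds_zero_nat (𝕜 := ℝ)
  refine squeeze_zero (fun k => add_nonneg (variance_nonneg _ _) (sq_nonneg _))
    (fun k => add_le_add (hv k) (sq_le_sq' (neg_le_of_abs_le (he k)) (le_of_abs_le (he k)))) ?_
  simpa using ht.add (ht.pow 2)

end Score

end MDP

/-! ### The three claims -/

theorem mainTheorem2 {S Act : Type*} [Fintype S] [Fintype Act] (M : MDP S Act)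
    (X : M.Path → ℝ) (hX : Measurable X)
    (hVpos : 0 < M.varMax X) (hVfin : M.varMax X < ∞)
    (hE : BddAbove (Set.range fun σ : M.Scheduler => |σ.expect X|))
    (hNDS : M.NDS X = 1) :
    (∀ ε : ℝ, 0 < ε →
      (∃ σ : M.Scheduler, σ.expect X ≤ M.expMin X + ε ∧ σ.var X ≤ ENNReal.ofReal ε) ∧
      (∃ σ : M.Scheduler, M.expMax X - ε ≤ σ.expect X ∧ σ.var X ≤ ENNReal.ofReal ε)) ∧
    (∀ σ₀ σ₁ : M.Scheduler, M.varDem X = σ₀.varPair σ₁ X →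
      (σ₀.Pr {ρ | X ρ = M.expMin X} = 1 ∧ σ₁.Pr {ρ | X ρ = M.expMax X} = 1) ∨
      (σ₁.Pr {ρ | X ρ = M.expMin X} = 1 ∧ σ₀.Pr {ρ | X ρ = M.expMax X} = 1)) ∧
    ((∃ C : ℝ, ∀ ρ, |X ρ| ≤ C) → Continuous X →
      (∃ σ : M.Scheduler, σ.Pr {ρ | X ρ = M.expMin X} = 1) ∧
      (∃ σ : M.Scheduler, σ.Pr {ρ | X ρ = M.expMax X} = 1)) := by
  have hL := MDP.memLp_of_varMax_lt_top hX hVfin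
  obtain ⟨C, hC⟩ := hE
  -- Boundedness makes the real-valued infimum and supremum genuine bounds rather than default
  -- values.
  have hbelow : BddBelow (Set.range fun σ : M.Scheduler => σ.expect X) :=
    ⟨-C, by rintro _ ⟨σ, rfl⟩; exact neg_le_of_abs_le (hC ⟨σ, rfl⟩)⟩
  have habove : BddAbove (Set.range fun σ : M.Scheduler => σ.expect X) :=
    ⟨C, by rintro _ ⟨σ, rfl⟩; exact le_of_abs_le (hC ⟨σ, rfl⟩)⟩
  have hnear : ∀ ε : ℝ, 0 < ε →
      (∃ σ : M.Scheduler, σ.expect X ≤ M.expMin X + ε ∧ variance X σ.Pr ≤ ε) ∧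
      (∃ σ : M.Scheduler, M.expMax X - ε ≤ σ.expect X ∧ variance X σ.Pr ≤ ε) := by
    intro ε hε
    obtain ⟨σ, τ, ⟨h₁, h₂⟩, h₃, h₄⟩ := MDP.exists_near_extremal hX hVfin hVpos hNDS hε
    have : Nonempty M.Scheduler := ⟨σ⟩
    exact ⟨⟨σ, sub_le_iff_le_add.1 (le_ciInf h₂), h₁⟩,
      ⟨τ, sub_le_iff_le_add.2 (ciSup_le h₄), h₃⟩⟩
  refine ⟨fun ε hε => ?_, fun σ τ h => ?_, fun _ hc => ?_⟩
  · obtain ⟨⟨σ, h₁, h₂⟩, τ, h₃, h₄⟩ := hnear ε hε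
    exact ⟨⟨σ, h₁, by
        rw [MDP.Scheduler.var_eq_ofReal_variance (hL σ)]; exact ENNReal.ofReal_le_ofReal h₂⟩,
      ⟨τ, h₃, by
        rw [MDP.Scheduler.var_eq_ofReal_variance (hL τ)]; exact ENNReal.ofReal_le_ofReal h₄⟩⟩
  · rw [MDP.varDem_eq_of_NDS_eq_one hVfin hVpos hNDS, σ.varPair_eq τ hX (hL σ) (hL τ)] at h
    have hv₁ := variance_nonneg X σ.Pr
    have hv₂ := variance_nonneg X τ.Pr
    rw [ENNReal.ofReal_eq_ofReal_iff (by positivity) (by positivity)] at h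
    rcases le_total (σ.expect X) (τ.expect X) with hle | hle
    · exact Or.inl (MDP.extremal_of_varPair_eq hX hVfin hle h.le)
    · rw [add_comm (variance X σ.Pr), sub_sq_comm] at h
      exact Or.inr (MDP.extremal_of_varPair_eq hX hVfin hle h.le)
  -- The first claim with ε = 1/(k+1) supplies the sequences of schedulers to which the compactness
  -- argument applies.
  · have hpos : ∀ k : ℕ, 0 < 1 / ((k : ℝ) + 1) := fun k => Nat.one_div_pos_of_nat
    constructor
    · choose s h₁ h₂ using fun k : ℕ => (hnear _ (hpos k)).1
      refine MDP.Scheduler.exists_Pr_eq_one hc hX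
        (MDP.tendsto_lintegral_sub_sq (fun k => hL (s k)) h₂ fun k => ?_)
      have h₃ : M.expMin X ≤ (s k).expect X := ciInf_le hbelow (s k)
      rw [abs_of_nonneg (sub_nonneg.2 h₃)]
      linarith [h₁ k]
    · choose s h₁ h₂ using fun k : ℕ => (hnear _ (hpos k)).2
      refine MDP.Scheduler.exists_Pr_eq_one hc hX
        (MDP.tendsto_lintegral_sub_sq (fun k => hL (s k)) h₂ fun k => ?_)
      have h₃ : (s k).expect X ≤ M.expMax X := le_ciSup habove (s k)
      rw [abs_of_nonpos (sub_nonpos.2 h₃)]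
      linarith [h₁ k]
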